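/- Let $H$ be a real Hilbert space with norm $\|\cdot\|$ and inner product $\langle\cdot,\cdot\rangle$, and let $A$ be a densely defined self-adjoint operator on $H$ such that the inclusion $D(A)\subset H$ ($D(A)$ with the graph norm) is compact and, for some $a>0$, $\langle Ax,x\rangle\ge a\|x\|^2$ for all $x\in D(A)$. Let $\lambda_1>0$ be the smallest eigenvalue of $A$. For $s\in\mathbb R$ let $A^s$ be the power defined through the eigenvector expansion: $A^s x=\sum_i\lambda_i^s\langle x,e_i\rangle e_i$ with $D(A^s)=\{x\in H:\sum_i\lambda_i^{2s}\langle x,e_i\rangle^2<\infty\}$, where $(e_i)$ is an orthonormal basis of $H$ with $Ae_i=\lambda_ie_i$. Put $V=D(A^{1/2})$ with $\|x\|_V=\|A^{1/2}x\|$ and $W=D(A)$ with $\|x\|_W=\|Ax\|$, let $V'$, $W'$ be their duals ($H$ being identified with its own dual), so that $\|x\|_{W'}=\langle A^{-2}x,x\rangle^{1/2}$ for $x\in H$. Let $\alpha\in\mathbb R$, $\alpha\ne0$, $\beta\in[0,\tfrac32]$ and $|\alpha|<\lambda_1^{(3-2\beta)/2}$. Then there is a constant $c>0$, depending only on $A,\alpha,\beta$,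 such that the following holds for every solution $(u,v)$ on $[0,\infty)$ of $$u''+u'+Au+\alpha A^\beta v=0,\qquad v''+A^2v+\alpha A^\beta u=0,$$ that is, for all $u\in C([0,\infty);V)\cap C^1([0,\infty);H)$ and $v\in C([0,\infty);W)\cap C^1([0,\infty);H)$ which satisfy the first equation in $V'$ and the second in $W'$ (tested against each fixed element of $V$, respectively of $W$). (i) If $\beta\in[0,1]$, then for all $t>0$ $$\|A^{\frac\beta2-1}u'(t)\|_{W'}^2+\|A^{\frac\beta2-1}v'(t)\|_{W'}^2+\|A^{\frac{\beta-1}2}u(t)\|_{W'}^2+\|A^{\frac\beta2}v(t)\|_{W'}^2\le\frac ct\left[\|u'(0)\|^2+\|v'(0)\|^2+\|u(0)\|_V^2+\|v(0)\|_W^2\right].$$ (ii) If $\beta\in[1,\tfrac32]$, then for all $t>0$ $$\|A^{-\frac\beta2}u'(t)\|_{W'}^2+\|A^{-\frac\beta2}v'(t)\|_{W'}^2+\|A^{\frac{1-\beta}2}u(t)\|_{W'}^2+\|A^{1-\frac\beta2}v(t)\|_{W'}^2\le\frac ct\left[\|u'(0)\|^2+\|v'(0)\|^2+\|u(0)\|_V^2+\|v(0)\|_W^2\right].$$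 -/

import Mathlib

open Set Filter Topology

noncomputable section

namespace CoupledSystem

variable {H : Type*} [NormedAddCommGroup H] [InnerProductSpace ℝ H]

/-- The inclusion of `D(A)`, with its graph norm, into `H` is compact: the unit ball of the graph
norm is relatively compact in `H`. -/
def HasCompactDomain (A : H →ₗ.[ℝ] H) : Prop :=
  IsCompact (closure ((fun x : A.domain => (x : H)) '' {x | ‖(x : H)‖ ^ 2 + ‖A x‖ ^ 2 ≤ 1}))

/-- The lower bound `⟨A x, x⟩ ≥ a ⟨x, x⟩` on `D(A)` for some `a > 0`. -/
def IsCoercive (A : H →ₗ.[ℝ] H) : Prop :=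
  ∃ a : ℝ, 0 < a ∧ ∀ x : A.domain, a * inner ℝ (x : H) (x : H) ≤ inner ℝ (A x) (x : H)

/-- The eigenspace `{x ∈ D(A) | A x = μ x}`, written with the graph of `A`. -/
def eigenspace (A : H →ₗ.[ℝ] H) (μ : ℝ) : Submodule ℝ H :=
  A.graph.comap (LinearMap.id.prod (μ • LinearMap.id))

theorem mem_eigenspace_iff (A : H →ₗ.[ℝ] H) (μ : ℝ) (x : H) :
    x ∈ eigenspace A μ ↔ ∃ y : A.domain, (y : H) = x ∧ A y = μ • x := by
  simp [eigenspace, LinearPMap.mem_graph_iff]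

/-- The set of eigenvalues of `A`. -/
def eigenvalues (A : H →ₗ.[ℝ] H) : Set ℝ := {μ | eigenspace A μ ≠ ⊥}

/-- The first (smallest) eigenvalue `λ₁` of `A`. -/
def firstEigenvalue (A : H →ₗ.[ℝ] H) : ℝ := sInf (eigenvalues A)

variable [CompleteSpace H]

/-- The orthogonal projection onto the eigenspace for `μ`; it is `0` if `μ` is not an eigenvalue.
(The eigenspaces of a self-adjoint operator are closed, so that taking the closure changes nothing
there; it makes the definition meaningful for every `A`.) -/
def eigenproj (A : H →ₗ.[ℝ] H) (μ : ℝ) : H →L[ℝ] H :=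
  (eigenspace A μ).topologicalClosure.starProjection

/-- `x ∈ D(A ^ s)`, that is `∑ μ ^ (2 s) ‖P_μ x‖ ^ 2 < ∞`, summed over the eigenvalues `μ` of `A`
(each term at a `μ` that is not an eigenvalue vanishes). -/
def InDomPow (A : H →ₗ.[ℝ] H) (s : ℝ) (x : H) : Prop :=
  Summable fun μ : ℝ => μ ^ (2 * s) * ‖eigenproj A μ x‖ ^ 2

/-- The power `A ^ s x = ∑ μ ^ s P_μ x`, for any real `s`, meaningful for `x ∈ D(A ^ s)`. In terms
of an orthonormal basis of eigenvectors `A e i = μ i e i` it is `∑ (μ i) ^ s ⟨x, e i⟩ e i`. -/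
def opPow (A : H →ₗ.[ℝ] H) (s : ℝ) (x : H) : H :=
  ∑' μ : ℝ, μ ^ s • eigenproj A μ x

/-- The norm of `V = D(A ^ (1/2))`. -/
def normV (A : H →ₗ.[ℝ] H) (x : H) : ℝ := ‖opPow A (1 / 2) x‖

/-- The norm of `W = D(A)`. -/
def normW (A : H →ₗ.[ℝ] H) (x : A.domain) : ℝ := ‖A x‖

/-- The norm of `W'`, the dual of `W = D(A)`, on the elements of `H ⊆ W'`:
`‖x‖_{W'} = ⟨A ^ (-2) x, x⟩ ^ (1/2)`. -/
def normW' (A : H →ₗ.[ℝ] H) (x : H) : ℝ := √(inner ℝ (opPow A (-2) x) x)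

/-- `(u, v)` is a (weak, finite energy) solution on `[0, ∞)` of
`u'' + u' + A u + α A ^ β v = 0`, `v'' + A ^ 2 v + α A ^ β u = 0`, with derivatives `u'` and `v'`:
`(u, v, u', v')` is continuous with values in `V × W × H × H`, the functions `u'` and `v'` are the
time derivatives of `u` and `v` in `H`, and the first equation holds in the dual `V'` of `V`, the
second in the dual `W'` of `W`. The duality pairings are written through
`⟨A u, φ⟩_{V',V} = ⟨A ^ (1/2) u, A ^ (1/2) φ⟩`,
`⟨A ^ β v, φ⟩_{V',V} = ⟨A ^ (β - 1/2) v, A ^ (1/2) φ⟩`,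
`⟨A ^ 2 v, ψ⟩_{W',W} = ⟨A v, A ψ⟩` and `⟨A ^ β u, ψ⟩_{W',W} = ⟨A ^ (β - 1) u, A ψ⟩`.
Values at negative times are irrelevant. -/
structure IsSolution (A : H →ₗ.[ℝ] H) (α β : ℝ)
    (u u' : ℝ → H) (v : ℝ → A.domain) (v' : ℝ → H) : Prop where
  u_mem : ∀ t, 0 ≤ t → InDomPow A (1 / 2) (u t)
  u_cont : ContinuousOn (fun t => opPow A (1 / 2) (u t)) (Ici 0)
  v_cont : ContinuousOn (fun t => A (v t)) (Ici 0)
  u'_cont : ContinuousOn u' (Ici 0)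
  v'_cont : ContinuousOn v' (Ici 0)
  u_deriv : ∀ t, 0 ≤ t → HasDerivWithinAt u (u' t) (Ici 0) t
  v_deriv : ∀ t, 0 ≤ t → HasDerivWithinAt (fun s => (v s : H)) (v' t) (Ici 0) t
  u_eq : ∀ φ : H, InDomPow A (1 / 2) φ → ∀ t, 0 ≤ t →
    HasDerivWithinAt (fun s => inner ℝ (u' s) φ)
      (-(inner ℝ (u' t) φ
        + inner ℝ (opPow A (1 / 2) (u t)) (opPow A (1 / 2) φ)
        + α * inner ℝ (opPow A (β - 1 / 2) (v t : H)) (opPow A (1 / 2) φ))) (Ici 0) t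
  v_eq : ∀ ψ : A.domain, ∀ t, 0 ≤ t →
    HasDerivWithinAt (fun s => inner ℝ (v' s) (ψ : H))
      (-(inner ℝ (A (v t)) (A ψ)
        + α * inner ℝ (opPow A (β - 1) (u t)) (A ψ))) (Ici 0) t

end CoupledSystem

end

namespace CoupledSystem

/-! Only `u` is damped, so dissipation reaches `v` through the coupling alone. Pairing the system
with an eigenvector for the eigenvalue `μ` gives two scalar oscillators, `x'' + x' + μ x + ρ μ² y =
0` and `y'' + μ² y + ρ μ² x = 0`, with `ρ = α μ ^ (β - 2)`. With `p = x'`, `r = y'`, `Z = x + ρ μ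
y`, `Y = μ y` and `θ = 1 - ρ² μ`, the energy `E = p² + r² + μ Z² + θ Y²` satisfies `E' = -2 p²`. The
assumption on `α` keeps `θ` above a positive constant uniformly in `μ`, so `E` is equivalent to the
natural energy.

A multiplier `G`, with `|G| ≤ C E`, recovers the remaining components: `p Z` yields `Z²`, `Z r`
yields `ρ² r²` through the coupling, and `Y r` shares the latter with `Y²` by equipartition. Hence
`G' ≤ -(ρ² / 4) E + C p²`, and `t ρ² E(t) ≤ C E(0)` with `C` independent of `μ` (`mode_decay`).

Since `ρ² = α² μ ^ (2 β - 4)`, a weight `μ ^ (-δ)` on the energy with `δ ≥ 4 - 2 β` compensates the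
degeneration at high frequency. Summing over the eigenspaces gives `IsSolution.weighted_decay`; the
two claims are the choices `δ = 4 - β` and `δ = 2 + β`. -/

/-! ### Decay of a single mode. -/

theorem mode_cross_term_le {θ ρ Z Y : ℝ} (hθ0 : 0 < θ) (hθ1 : θ ≤ 1) :
    ρ * (θ - (1 - θ) / 2) * (Z * Y) ≤ ρ ^ 2 * θ * Y ^ 2 / 4 + Z ^ 2 / θ := by
  have h1 : (θ - (1 - θ) / 2) ^ 2 ≤ 1 := by nlinarith
  have h2 : ρ * (θ - (1 - θ) / 2) * (Z * Y)
      ≤ ρ ^ 2 * θ * Y ^ 2 / 4 + (θ - (1 - θ) / 2) ^ 2 * Z ^ 2 / θ := by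
    rw [← sub_nonneg]
    have : ρ ^ 2 * θ * Y ^ 2 / 4 + (θ - (1 - θ) / 2) ^ 2 * Z ^ 2 / θ
        - ρ * (θ - (1 - θ) / 2) * (Z * Y)
        = (ρ * θ * Y / 2 - (θ - (1 - θ) / 2) * Z) ^ 2 / θ := by field_simp; ring
    rw [this]; positivity
  have h3 : (θ - (1 - θ) / 2) ^ 2 * Z ^ 2 / θ ≤ Z ^ 2 / θ := by
    gcongr; exact mul_le_of_le_one_left (sq_nonneg Z) h1
  linarith

/-- Pointwise estimate behind the decay of one mode: `dG ≤ -(ρ² / 4) E + C p²`. -/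
theorem mode_multiplier_le {l θ₀ μ ρ p Z r Y : ℝ} (hl : 0 < l) (hθ₀ : 0 < θ₀)
    (hμ : l ≤ μ) (hθ : θ₀ ≤ 1 - ρ ^ 2 * μ) :
    4 / θ₀ / μ * ((-p - μ * Z) * Z + p * (p + ρ * μ * r))
      - ρ / μ * ((p + ρ * μ * r) * r + Z * (-(μ * (1 - ρ ^ 2 * μ) * Y) - ρ * μ ^ 2 * Z))
      + ρ ^ 2 / (2 * μ) * (μ * r * r + Y * (-(μ * (1 - ρ ^ 2 * μ) * Y) - ρ * μ ^ 2 * Z))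
    ≤ -(ρ ^ 2 / 4) * (p ^ 2 + r ^ 2 + μ * Z ^ 2 + (1 - ρ ^ 2 * μ) * Y ^ 2)
      + (4 / θ₀ / l ^ 2 + 4 / θ₀ / l + 2 * (4 / θ₀) ^ 2 + 2 / l ^ 2 + 1 / (4 * l)) * p ^ 2 := by
  have hμ0 : 0 < μ := hl.trans_le hμ
  obtain ⟨θ, hθe⟩ : ∃ θ, θ = 1 - ρ ^ 2 * μ := ⟨_, rfl⟩
  have hρμ : ρ ^ 2 * μ = 1 - θ := by linarith
  rw [← hθe] at hθ ⊢
  have hθ0 : 0 < θ := hθ₀.trans_le hθ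
  have hθ1 : θ ≤ 1 := by
    have : 0 ≤ ρ ^ 2 * μ := by positivity
    linarith
  obtain ⟨K, hK⟩ : ∃ K, K = 4 / θ₀ := ⟨_, rfl⟩
  rw [← hK]
  have hK0 : 0 < K := by rw [hK]; positivity
  have hKθ : 4 ≤ K * θ := by
    rw [hK, div_mul_eq_mul_div, le_div_iff₀ hθ₀]; nlinarith
  obtain ⟨m, hm⟩ : ∃ m, m = 1 / μ := ⟨_, rfl⟩
  have hm0 : 0 < m := by rw [hm]; positivity
  have hmμ : m * μ = 1 := by rw [hm]; field_simp
  have hml : m ≤ 1 / l := by rw [hm]; exact one_div_le_one_div_of_le hl hμ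
  have hρm : ρ ^ 2 ≤ m := by
    have : ρ ^ 2 = (1 - θ) * m := by rw [← hρμ]; linear_combination (-ρ ^ 2) * hmμ
    rw [this]; nlinarith
  -- The useful terms are `-K Z²`, `-ρ² r² / 2` and `-ρ² θ Y² / 2`; everything else has to be
  -- absorbed by them or by `p²`.
  have e1 : K / μ * ((-p - μ * Z) * Z + p * (p + ρ * μ * r))
      - ρ / μ * ((p + ρ * μ * r) * r + Z * (-(μ * θ * Y) - ρ * μ ^ 2 * Z))
      + ρ ^ 2 / (2 * μ) * (μ * r * r + Y * (-(μ * θ * Y) - ρ * μ ^ 2 * Z))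
      = K * (-(m * p * Z) - Z ^ 2 + m * p ^ 2 + ρ * p * r) - ρ * m * p * r
        - ρ ^ 2 * r ^ 2 / 2 - ρ ^ 2 * θ * Y ^ 2 / 2 + ρ * (θ - (1 - θ) / 2) * (Z * Y)
        + (1 - θ) * Z ^ 2 := by
    rw [← hρμ, hm]; field_simp; ring
  rw [e1]
  -- The budget is exact. `K Z²` is spent as `K/4` here, `K/4` in `a5` and `K/2` in `a6`; half of
  -- the good `r²` term goes to `a2` and `a3`, and half of the good `Y²` term to `a4`. The choice `K
  -- = 4 / θ₀` is what `a5` needs.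
  have a1 : -(K * (m * p * Z)) ≤ K * (Z ^ 2 / 4 + m ^ 2 * p ^ 2) := by
    linarith [mul_nonneg hK0.le (sq_nonneg (Z / 2 + m * p))]
  have a2 : K * (ρ * p * r) ≤ ρ ^ 2 * r ^ 2 / 8 + 2 * K ^ 2 * p ^ 2 := by
    linarith [sq_nonneg (ρ * r / 2 - 2 * K * p)]
  have a3 : -(ρ * m * p * r) ≤ ρ ^ 2 * r ^ 2 / 8 + 2 * m ^ 2 * p ^ 2 := by
    linarith [sq_nonneg (ρ * r / 2 + 2 * m * p)]
  have a4 := mode_cross_term_le (ρ := ρ) (Z := Z) (Y := Y) hθ0 hθ1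
  have a5 : Z ^ 2 / θ ≤ K / 4 * Z ^ 2 := by
    rw [div_le_iff₀ hθ0]; linarith [mul_le_mul_of_nonneg_right hKθ (sq_nonneg Z)]
  have hK4 : 4 ≤ K := by linarith [mul_le_mul_of_nonneg_left hθ1 hK0.le]
  have a6 : (1 - θ) * Z ^ 2 + ρ ^ 2 / 4 * (μ * Z ^ 2) ≤ K / 2 * Z ^ 2 := by
    have : ρ ^ 2 / 4 * (μ * Z ^ 2) = (1 - θ) / 4 * Z ^ 2 := by rw [← hρμ]; ring
    rw [this]
    have h1 : 1 - θ + (1 - θ) / 4 ≤ K / 2 := by linarith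
    linarith [mul_le_mul_of_nonneg_right h1 (sq_nonneg Z)]
  have hm2 : m ^ 2 ≤ 1 / l ^ 2 := by
    rw [← one_div_pow]; gcongr
  have a7 : K * (m ^ 2 * p ^ 2) + K * (m * p ^ 2) + 2 * m ^ 2 * p ^ 2 + ρ ^ 2 / 4 * p ^ 2
      ≤ (K / l ^ 2 + K / l + 2 / l ^ 2 + 1 / (4 * l)) * p ^ 2 := by
    have : K / l ^ 2 + K / l + 2 / l ^ 2 + 1 / (4 * l)
      = K * (1 / l ^ 2) + K * (1 / l) + 2 * (1 / l ^ 2) + (1 / l) / 4 := by field_simp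
    rw [this]
    have : K * m ^ 2 + K * m + 2 * m ^ 2 + ρ ^ 2 / 4
      ≤ K * (1 / l ^ 2) + K * (1 / l) + 2 * (1 / l ^ 2) + (1 / l) / 4 := by
      gcongr; linarith
    linarith [mul_le_mul_of_nonneg_right this (sq_nonneg p)]
  linarith

/-- Each product is at most a sum of squares, and `μ ≥ l`, `ρ² ≤ 1 / l` and `θ ≥ θ₀` bound the
weights uniformly. Thus adding a multiple of the energy makes the multiplier nonnegative. -/
theorem abs_mode_multiplier_le {l θ₀ μ ρ p Z r Y : ℝ} (hl : 0 < l) (hθ₀ : 0 < θ₀)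
    (hμ : l ≤ μ) (hθ : θ₀ ≤ 1 - ρ ^ 2 * μ) :
    |4 / θ₀ / μ * (p * Z) - ρ / μ * (Z * r) + ρ ^ 2 / (2 * μ) * (Y * r)|
      ≤ (4 / θ₀ / l * (1 + 1 / l) + 1 / l * (1 + 1 / l ^ 2) + 1 / l ^ 2 * (1 + 1 / θ₀))
        * (p ^ 2 + r ^ 2 + μ * Z ^ 2 + (1 - ρ ^ 2 * μ) * Y ^ 2) := by
  have hμ0 : 0 < μ := hl.trans_le hμ
  obtain ⟨θ, hθe⟩ : ∃ θ, θ = 1 - ρ ^ 2 * μ := ⟨_, rfl⟩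
  have hρμ : ρ ^ 2 * μ ≤ 1 := by linarith
  rw [← hθe] at hθ ⊢
  have hθ0 : 0 < θ := hθ₀.trans_le hθ
  set E := p ^ 2 + r ^ 2 + μ * Z ^ 2 + θ * Y ^ 2 with hE
  have hZ0 : 0 ≤ μ * Z ^ 2 := by positivity
  have hY0 : 0 ≤ θ * Y ^ 2 := by positivity
  have hp : p ^ 2 ≤ E := by linarith [sq_nonneg r]
  have hr : r ^ 2 ≤ E := by linarith [sq_nonneg p]
  have hE0 : 0 ≤ E := (sq_nonneg p).trans hp
  have hZ' : μ * Z ^ 2 ≤ E := by linarith [sq_nonneg p, sq_nonneg r]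
  have hY' : θ * Y ^ 2 ≤ E := by linarith [sq_nonneg p, sq_nonneg r]
  have hZ : Z ^ 2 ≤ 1 / l * E := by
    rw [one_div_mul_eq_div, le_div_iff₀ hl]; nlinarith [sq_nonneg Z]
  have hY : Y ^ 2 ≤ 1 / θ₀ * E := by
    rw [one_div_mul_eq_div, le_div_iff₀ hθ₀]; nlinarith [sq_nonneg Y]
  have abs2 (a b : ℝ) : |a * b| ≤ a ^ 2 + b ^ 2 := by
    rw [abs_le]; constructor <;> nlinarith [sq_nonneg (a + b), sq_nonneg (a - b)]
  have hρl : ρ ^ 2 ≤ 1 / l := by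
    rw [le_div_iff₀ hl]; nlinarith [sq_nonneg ρ]
  have b1 : |4 / θ₀ / μ * (p * Z)| ≤ 4 / θ₀ / l * (1 + 1 / l) * E := by
    rw [abs_mul, abs_of_pos (by positivity), mul_assoc]
    gcongr
    linarith [abs2 p Z]
  have b2 : |ρ / μ * (Z * r)| ≤ 1 / l * (1 + 1 / l ^ 2) * E := by
    have h : |ρ * Z * r| ≤ (1 + 1 / l ^ 2) * E := by
      refine (abs2 _ _).trans ?_
      have : (ρ * Z) ^ 2 ≤ 1 / l ^ 2 * E := by
        calc (ρ * Z) ^ 2 = ρ ^ 2 * Z ^ 2 := mul_pow _ _ _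
          _ ≤ 1 / l * (1 / l * E) := by gcongr
          _ = 1 / l ^ 2 * E := by field_simp
      linarith
    have : ρ / μ * (Z * r) = 1 / μ * (ρ * Z * r) := by ring
    rw [this, abs_mul, abs_of_pos (by positivity), mul_assoc (1 / l)]
    gcongr
  have b3 : |ρ ^ 2 / (2 * μ) * (Y * r)| ≤ 1 / l ^ 2 * (1 + 1 / θ₀) * E := by
    have : ρ ^ 2 / (2 * μ) ≤ 1 / l ^ 2 := by
      rw [div_le_div_iff₀ (by positivity) (by positivity)]
      have : ρ ^ 2 * l ≤ 1 := by rwa [le_div_iff₀ hl] at hρl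
      nlinarith
    rw [abs_mul, abs_of_nonneg (by positivity), mul_assoc]
    gcongr
    linarith [abs2 Y r]
  calc _ ≤ |4 / θ₀ / μ * (p * Z)| + |ρ / μ * (Z * r)| + |ρ ^ 2 / (2 * μ) * (Y * r)| :=
        (abs_add_le _ _).trans (by gcongr; exact abs_sub _ _)
    _ ≤ _ := by linarith

/-- Polynomial decay of one mode, with a constant uniform in the eigenvalue `μ ≥ l`. -/
theorem mode_decay {l q : ℝ} (hl : 0 < l) (hq0 : 0 ≤ q) (hq : q < 1) :
    ∃ C : ℝ, 0 < C ∧ ∀ μ ρ : ℝ, l ≤ μ → ρ ^ 2 * μ ≤ q ^ 2 → ∀ x p y r : ℝ → ℝ,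
      (∀ t, 0 ≤ t → HasDerivWithinAt x (p t) (Ici 0) t) →
      (∀ t, 0 ≤ t → HasDerivWithinAt y (r t) (Ici 0) t) →
      (∀ t, 0 ≤ t → HasDerivWithinAt p (-(p t + μ * x t + ρ * μ ^ 2 * y t)) (Ici 0) t) →
      (∀ t, 0 ≤ t → HasDerivWithinAt r (-(μ ^ 2 * y t + ρ * μ ^ 2 * x t)) (Ici 0) t) →
      ∀ t, 0 ≤ t →
        t * ρ ^ 2 * (p t ^ 2 + r t ^ 2 + μ * x t ^ 2 + μ ^ 2 * y t ^ 2)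
          ≤ C * (p 0 ^ 2 + r 0 ^ 2 + μ * x 0 ^ 2 + μ ^ 2 * y 0 ^ 2) := by
  obtain ⟨θ₀, hθe⟩ : ∃ θ₀, θ₀ = 1 - q ^ 2 := ⟨_, rfl⟩
  have hθ₀ : 0 < θ₀ := by nlinarith
  obtain ⟨C₂, hC₂⟩ : ∃ C, C = 4 / θ₀ / l ^ 2 + 4 / θ₀ / l + 2 * (4 / θ₀) ^ 2 + 2 / l ^ 2
    + 1 / (4 * l) := ⟨_, rfl⟩
  obtain ⟨C₃, hC₃⟩ : ∃ C, C = 4 / θ₀ / l * (1 + 1 / l) + 1 / l * (1 + 1 / l ^ 2)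
    + 1 / l ^ 2 * (1 + 1 / θ₀) := ⟨_, rfl⟩
  have hC₂0 : 0 < C₂ := by rw [hC₂]; positivity
  have hC₃0 : 0 < C₃ := by rw [hC₃]; positivity
  have hq1 : 0 < 1 - q := by linarith
  refine ⟨4 * (C₂ / 2 + 2 * C₃) * 2 / (1 - q), by positivity, ?_⟩
  intro μ ρ hμ hρ x p y r hx hy hp hr t ht
  have hμ0 : 0 < μ := hl.trans_le hμ
  have hθ : θ₀ ≤ 1 - ρ ^ 2 * μ := by linarith
  -- `Z` completes the square in the potential energy, so that the coupling energy is absorbed.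
  set Z : ℝ → ℝ := fun s => x s + ρ * μ * y s with hZ
  set Y : ℝ → ℝ := fun s => μ * y s with hY
  set E : ℝ → ℝ := fun s => p s ^ 2 + r s ^ 2 + μ * Z s ^ 2 + (1 - ρ ^ 2 * μ) * Y s ^ 2 with hE
  set G : ℝ → ℝ := fun s => 4 / θ₀ / μ * (p s * Z s) - ρ / μ * (Z s * r s)
    + ρ ^ 2 / (2 * μ) * (Y s * r s) with hG
  have hpd (s : ℝ) (hs : 0 ≤ s) : HasDerivWithinAt p (-p s - μ * Z s) (Ici 0) s :=
    (hp s hs).congr_deriv (by simp only [hZ]; ring)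
  have hrd (s : ℝ) (hs : 0 ≤ s) :
      HasDerivWithinAt r (-(μ * (1 - ρ ^ 2 * μ) * Y s) - ρ * μ ^ 2 * Z s) (Ici 0) s :=
    (hr s hs).congr_deriv (by simp only [hZ, hY]; ring)
  have hYd (s : ℝ) (hs : 0 ≤ s) : HasDerivWithinAt Y (μ * r s) (Ici 0) s :=
    (hy s hs).const_mul μ
  have hZd (s : ℝ) (hs : 0 ≤ s) : HasDerivWithinAt Z (p s + ρ * μ * r s) (Ici 0) s :=
    (hx s hs).add ((hy s hs).const_mul (ρ * μ))
  have hEd (s : ℝ) (hs : 0 ≤ s) : HasDerivWithinAt E (-2 * p s ^ 2) (Ici 0) s := by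
    have := ((((hpd s hs).pow 2).add ((hrd s hs).pow 2)).add
      (((hZd s hs).pow 2).const_mul μ)).add (((hYd s hs).pow 2).const_mul (1 - ρ ^ 2 * μ))
    refine this.congr_deriv ?_
    push_cast; ring
  have hGd (s : ℝ) (hs : 0 ≤ s) := ((((hpd s hs).mul (hZd s hs)).const_mul (4 / θ₀ / μ)).sub
      (((hZd s hs).mul (hrd s hs)).const_mul (ρ / μ))).add
      (((hYd s hs).mul (hrd s hs)).const_mul (ρ ^ 2 / (2 * μ)))
  have hE0 (s : ℝ) : 0 ≤ E s := by
    have : 0 ≤ 1 - ρ ^ 2 * μ := hθ₀.le.trans hθ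
    simp only [hE]; positivity
  have hGE (s : ℝ) : |G s| ≤ C₃ * E s := by
    rw [hC₃]; exact abs_mode_multiplier_le hl hθ₀ hμ hθ
  -- As `E' = -2 p²`, the multiple `C₂ / 2` cancels the `C₂ p²` from the multiplier, and `C₃`
  -- compensates a negative `G`. Differentiating the factor `s` gives `(ρ² / 4) E`, exactly the
  -- decay that `G` provides.
  have hanti : AntitoneOn
      (fun s => G s + (C₂ / 2 + C₃) * E s + ρ ^ 2 / 4 * (s * E s)) (Ici 0) := by
    have hΦ (s : ℝ) (hs : 0 ≤ s) := ((hGd s hs).add ((hEd s hs).const_mul (C₂ / 2 + C₃))).add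
      (((hasDerivWithinAt_id s (Ici 0)).mul (hEd s hs)).const_mul (ρ ^ 2 / 4))
    refine antitoneOn_of_hasDerivWithinAt_nonpos (convex_Ici 0)
      (fun s hs => (hΦ s hs).continuousWithinAt)
      (fun s hs => (hΦ s (interior_subset hs)).mono interior_subset) ?_
    intro s hs
    have hs0 : 0 ≤ s := interior_subset hs
    have h := mode_multiplier_le (p := p s) (Z := Z s) (r := r s) (Y := Y s) hl hθ₀ hμ hθ
    rw [← hC₂] at h
    have h1 : 0 ≤ ρ ^ 2 / 4 * (s * (2 * p s ^ 2)) := by positivity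
    have h2 : 0 ≤ C₃ * (2 * p s ^ 2) := by positivity
    have h3 : E s = p s ^ 2 + r s ^ 2 + μ * Z s ^ 2 + (1 - ρ ^ 2 * μ) * Y s ^ 2 := rfl
    rw [← h3] at h
    simp only [id]
    linarith
  have hdec := hanti (mem_Ici.2 le_rfl) (mem_Ici.2 ht) ht
  simp only [zero_mul, mul_zero, add_zero] at hdec
  have hEt : t * ρ ^ 2 * E t ≤ 4 * (C₂ / 2 + 2 * C₃) * E 0 := by
    have h1 := (abs_le.1 (hGE t)).1
    have h2 := (abs_le.1 (hGE 0)).2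
    have h3 : 0 ≤ C₂ * E t := mul_nonneg hC₂0.le (hE0 t)
    linarith
  have hEeq (s : ℝ) : E s = p s ^ 2 + r s ^ 2 + μ * x s ^ 2 + μ ^ 2 * y s ^ 2
      + 2 * (ρ * μ * x s * (μ * y s)) := by simp only [hE, hZ, hY]; ring
  -- Since `ρ² μ ≤ q²` with `q < 1`, the coupling energy is a strict fraction of the potential
  -- energy; this makes `E` and the natural energy comparable.
  have hcross (s : ℝ) : |2 * (ρ * μ * x s * (μ * y s))|
      ≤ q * (μ * x s ^ 2 + μ ^ 2 * y s ^ 2) := by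
    refine abs_le_of_sq_le_sq ?_ (by positivity)
    calc (2 * (ρ * μ * x s * (μ * y s))) ^ 2
        = (ρ ^ 2 * μ) * (4 * (μ * x s ^ 2) * (μ ^ 2 * y s ^ 2)) := by ring
      _ ≤ q ^ 2 * (4 * (μ * x s ^ 2) * (μ ^ 2 * y s ^ 2)) := by gcongr
      _ ≤ q ^ 2 * (μ * x s ^ 2 + μ ^ 2 * y s ^ 2) ^ 2 := by
        gcongr; exact four_mul_le_sq_add _ _
      _ = _ := by ring
  set N : ℝ → ℝ := fun s => p s ^ 2 + r s ^ 2 + μ * x s ^ 2 + μ ^ 2 * y s ^ 2 with hN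
  have hNge (s : ℝ) : μ * x s ^ 2 + μ ^ 2 * y s ^ 2 ≤ N s := by
    simp only [hN]; nlinarith [sq_nonneg (p s), sq_nonneg (r s)]
  have hN0 (s : ℝ) : 0 ≤ N s := by simp only [hN]; positivity
  have hlow (s : ℝ) : (1 - q) * N s ≤ E s := by
    have := (abs_le.1 (hcross s)).1
    have h := mul_le_mul_of_nonneg_left (hNge s) hq0
    rw [hEeq]; simp only [hN] at h ⊢; linarith
  have hupp : E 0 ≤ 2 * N 0 := by
    have := (abs_le.1 (hcross 0)).2
    have h := mul_le_mul_of_nonneg_left (hNge 0) hq0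
    have h' := mul_le_mul_of_nonneg_right hq.le (hN0 0)
    rw [hEeq]; simp only [hN] at h h' ⊢; linarith
  rw [div_mul_eq_mul_div, le_div_iff₀ hq1]
  calc t * ρ ^ 2 * N t * (1 - q) = t * ρ ^ 2 * ((1 - q) * N t) := by ring
    _ ≤ t * ρ ^ 2 * E t := by gcongr; exact hlow t
    _ ≤ 4 * (C₂ / 2 + 2 * C₃) * E 0 := hEt
    _ ≤ 4 * (C₂ / 2 + 2 * C₃) * (2 * N 0) := by gcongr
    _ = _ := by ring

/-! ### Eigenspaces, spectral projections and powers of `A`. -/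

theorem exists_le_eigenvalues {H : Type*} [NormedAddCommGroup H] [InnerProductSpace ℝ H]
    {A : H →ₗ.[ℝ] H} (hcoercive : IsCoercive A) :
    ∃ a : ℝ, 0 < a ∧ ∀ μ ∈ eigenvalues A, a ≤ μ := by
  obtain ⟨a, ha, h⟩ := hcoercive
  refine ⟨a, ha, fun μ hμ => ?_⟩
  obtain ⟨x, hx, hx0⟩ := (Submodule.ne_bot_iff _).1 hμ
  obtain ⟨x, rfl, hAx⟩ := (mem_eigenspace_iff A μ x).1 hx
  have h1 := h x
  rw [hAx, real_inner_smul_left] at h1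
  exact le_of_mul_le_mul_right h1 (real_inner_self_pos.2 hx0)

section Spectral

variable {H : Type*} [NormedAddCommGroup H] [InnerProductSpace ℝ H] [CompleteSpace H]
  {A : H →ₗ.[ℝ] H}

theorem inner_apply_comm (hdense : Dense (A.domain : Set H)) (hself : IsSelfAdjoint A)
    (x y : A.domain) : inner ℝ (A x) (y : H) = inner ℝ (x : H) (A y) := by
  have h := LinearPMap.adjoint_isFormalAdjoint hdense
  rw [LinearPMap.isSelfAdjoint_def.1 hself] at h
  exact h x y

theorem isClosed_eigenspace (hself : IsSelfAdjoint A) (μ : ℝ) :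
    IsClosed (eigenspace A μ : Set H) := by
  have hA : IsClosed (A.graph : Set (H × H)) := hself.isClosed
  exact hA.preimage (f := fun x : H => (x, μ • x)) (by fun_prop)

theorem eigenproj_mem (hself : IsSelfAdjoint A) (μ : ℝ) (x : H) :
    eigenproj A μ x ∈ eigenspace A μ := by
  have h : eigenproj A μ x ∈ (eigenspace A μ).topologicalClosure :=
    Submodule.starProjection_apply_mem _ x
  rwa [(isClosed_eigenspace hself μ).submodule_topologicalClosure_eq] at h

theorem inner_eigenproj (μ : ℝ) (x : H) {φ : H} (hφ : φ ∈ eigenspace A μ) :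
    inner ℝ (eigenproj A μ x) φ = inner ℝ x φ := by
  have h := Submodule.starProjection_inner_eq_zero (K := (eigenspace A μ).topologicalClosure) x φ
    ((eigenspace A μ).le_topologicalClosure hφ)
  rw [inner_sub_left] at h
  exact (sub_eq_zero.1 h).symm

theorem eigenproj_eq_of_inner (hself : IsSelfAdjoint A) {μ : ℝ} {x y : H}
    (hy : y ∈ eigenspace A μ)
    (h : ∀ φ ∈ eigenspace A μ, inner ℝ x φ = inner ℝ y φ) : eigenproj A μ x = y := by
  have hz : eigenproj A μ x - y ∈ eigenspace A μ := sub_mem (eigenproj_mem hself μ x) hy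
  rw [← sub_eq_zero, ← inner_self_eq_zero (𝕜 := ℝ)]
  nth_rw 1 [inner_sub_left]
  rw [inner_eigenproj μ x hz, h _ hz, sub_self]

theorem inner_eq_zero_of_mem_eigenspace (hdense : Dense (A.domain : Set H))
    (hself : IsSelfAdjoint A) {μ ν : ℝ} (hμν : μ ≠ ν) {x y : H} (hx : x ∈ eigenspace A μ)
    (hy : y ∈ eigenspace A ν) : inner ℝ x y = 0 := by
  obtain ⟨x, rfl, hx⟩ := (mem_eigenspace_iff A μ x).1 hx
  obtain ⟨y, rfl, hy⟩ := (mem_eigenspace_iff A ν y).1 hy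
  have h := inner_apply_comm hdense hself x y
  rw [hx, hy, real_inner_smul_left, real_inner_smul_right] at h
  exact (mul_eq_zero.1 (by linarith : (μ - ν) * inner ℝ (x : H) (y : H) = 0)).resolve_left
    (sub_ne_zero.2 hμν)

theorem orthogonalFamily_eigenspace (hdense : Dense (A.domain : Set H))
    (hself : IsSelfAdjoint A) :
    OrthogonalFamily ℝ (fun μ => eigenspace A μ) fun μ => (eigenspace A μ).subtypeₗᵢ :=
  fun _ _ hμν x y => inner_eq_zero_of_mem_eigenspace hdense hself hμν x.2 y.2

theorem eigenproj_of_mem (hself : IsSelfAdjoint A) {μ : ℝ} {x : H} (hx : x ∈ eigenspace A μ) :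
    eigenproj A μ x = x :=
  eigenproj_eq_of_inner hself hx fun _ _ => rfl

theorem eigenproj_of_mem_of_ne (hdense : Dense (A.domain : Set H)) (hself : IsSelfAdjoint A)
    {μ ν : ℝ} (hμν : ν ≠ μ) {x : H} (hx : x ∈ eigenspace A μ) : eigenproj A ν x = 0 :=
  eigenproj_eq_of_inner hself (zero_mem _) fun φ hφ => by
    rw [inner_eq_zero_of_mem_eigenspace hdense hself hμν.symm hx hφ, inner_zero_left]

theorem eigenproj_of_notMem (hself : IsSelfAdjoint A) {μ : ℝ} (hμ : μ ∉ eigenvalues A) (x : H) :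
    eigenproj A μ x = 0 := by
  have h : eigenspace A μ = ⊥ := not_not.1 hμ
  simpa [h] using eigenproj_mem hself μ x

theorem norm_eigenproj_sq (hself : IsSelfAdjoint A) (μ : ℝ) (x : H) :
    ‖eigenproj A μ x‖ ^ 2 = inner ℝ (eigenproj A μ x) x := by
  rw [← real_inner_self_eq_norm_sq, inner_eigenproj μ x (eigenproj_mem hself μ x),
    real_inner_comm]

theorem eigenproj_apply (hdense : Dense (A.domain : Set H)) (hself : IsSelfAdjoint A) (μ : ℝ)
    (x : A.domain) : eigenproj A μ (A x) = μ • eigenproj A μ (x : H) := by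
  refine eigenproj_eq_of_inner hself (Submodule.smul_mem _ _ (eigenproj_mem hself μ _)) ?_
  intro φ hφ
  rw [real_inner_smul_left, inner_eigenproj μ _ hφ]
  obtain ⟨φ, rfl, hφ'⟩ := (mem_eigenspace_iff A μ φ).1 hφ
  rw [inner_apply_comm hdense hself, hφ', real_inner_smul_right]

/-- Bessel's inequality: by orthogonality `S = ∑ P_μ x` satisfies `‖S‖² = ⟨S, x⟩ ≤ ‖S‖ ‖x‖`. -/
theorem sum_norm_eigenproj_sq_le (hdense : Dense (A.domain : Set H)) (hself : IsSelfAdjoint A)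
    (x : H) (s : Finset ℝ) : ∑ μ ∈ s, ‖eigenproj A μ x‖ ^ 2 ≤ ‖x‖ ^ 2 := by
  have h1 : ‖∑ μ ∈ s, eigenproj A μ x‖ ^ 2 = ∑ μ ∈ s, ‖eigenproj A μ x‖ ^ 2 :=
    (orthogonalFamily_eigenspace hdense hself).norm_sum
      (fun μ => ⟨eigenproj A μ x, eigenproj_mem hself μ x⟩) s
  have h2 : inner ℝ (∑ μ ∈ s, eigenproj A μ x) x = ∑ μ ∈ s, ‖eigenproj A μ x‖ ^ 2 := by
    rw [sum_inner]
    exact Finset.sum_congr rfl fun μ _ => (norm_eigenproj_sq hself μ x).symm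
  have h3 := real_inner_le_norm (∑ μ ∈ s, eigenproj A μ x) x
  nlinarith [sq_nonneg (‖∑ μ ∈ s, eigenproj A μ x‖ - ‖x‖)]

theorem summable_norm_eigenproj_sq (hdense : Dense (A.domain : Set H)) (hself : IsSelfAdjoint A)
    (x : H) : Summable fun μ => ‖eigenproj A μ x‖ ^ 2 :=
  summable_of_sum_le (fun _ => sq_nonneg _) (sum_norm_eigenproj_sq_le hdense hself x)

theorem tsum_norm_eigenproj_sq_le (hdense : Dense (A.domain : Set H)) (hself : IsSelfAdjoint A)
    (x : H) : ∑' μ, ‖eigenproj A μ x‖ ^ 2 ≤ ‖x‖ ^ 2 :=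
  (summable_norm_eigenproj_sq hdense hself x).tsum_le_of_sum_le
    (sum_norm_eigenproj_sq_le hdense hself x)

theorem InDomPow.zero (hdense : Dense (A.domain : Set H)) (hself : IsSelfAdjoint A) (x : H) :
    InDomPow A 0 x := by
  simpa [InDomPow] using summable_norm_eigenproj_sq hdense hself x

theorem InDomPow.one (hdense : Dense (A.domain : Set H)) (hself : IsSelfAdjoint A)
    (x : A.domain) : InDomPow A 1 (x : H) := by
  have h := summable_norm_eigenproj_sq hdense hself (A x)
  simpa [InDomPow, eigenproj_apply hdense hself, norm_smul, mul_pow] using h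

theorem InDomPow.mono (hself : IsSelfAdjoint A) (hcoercive : IsCoercive A) {s s' : ℝ} {x : H}
    (h : InDomPow A s' x) (hs : s ≤ s') : InDomPow A s x := by
  obtain ⟨a, ha, hle⟩ := exists_le_eigenvalues hcoercive
  rw [InDomPow] at h ⊢
  refine (summable_norm_iff.2 (h.mul_left (a ^ (2 * s - 2 * s')))).of_norm_bounded fun μ => ?_
  -- Real powers behave as expected only for positive bases. Eigenvalues are positive by coercivity,
  -- and off them the projection vanishes.
  by_cases hμ : μ ∈ eigenvalues A
  · have hμ0 : 0 < μ := ha.trans_le (hle μ hμ)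
    rw [Real.norm_of_nonneg (by positivity), Real.norm_of_nonneg (by positivity), ← mul_assoc]
    gcongr
    calc μ ^ (2 * s) = μ ^ (2 * s - 2 * s') * μ ^ (2 * s') := by
          rw [← Real.rpow_add hμ0]; ring_nf
      _ ≤ a ^ (2 * s - 2 * s') * μ ^ (2 * s') := by
          gcongr ?_ * _
          exact Real.rpow_le_rpow_of_nonpos ha (hle μ hμ) (by linarith)
  · simp [eigenproj_of_notMem hself hμ]

theorem InDomPow.summable (hdense : Dense (A.domain : Set H)) (hself : IsSelfAdjoint A)
    (hcoercive : IsCoercive A) {s : ℝ} {x : H} (h : InDomPow A s x) :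
    Summable fun μ : ℝ => μ ^ s • eigenproj A μ x := by
  obtain ⟨a, ha, hle⟩ := exists_le_eigenvalues hcoercive
  have key := (orthogonalFamily_eigenspace hdense hself).summable_iff_norm_sq_summable
    (fun μ : ℝ => ⟨μ ^ s • eigenproj A μ x,
      Submodule.smul_mem _ _ (eigenproj_mem hself μ x)⟩)
  refine key.2 (h.congr fun μ => ?_)
  by_cases hμ : μ ∈ eigenvalues A
  · have hμ0 : 0 < μ := ha.trans_le (hle μ hμ)
    change _ = ‖μ ^ s • eigenproj A μ x‖ ^ 2
    rw [norm_smul, mul_pow, Real.norm_of_nonneg (by positivity), ← Real.rpow_mul_natCast hμ0.le]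
    push_cast
    rw [mul_comm s 2]
  · change _ = ‖μ ^ s • eigenproj A μ x‖ ^ 2
    simp [eigenproj_of_notMem hself hμ]

theorem InDomPow.of_mem_eigenspace (hdense : Dense (A.domain : Set H)) (hself : IsSelfAdjoint A)
    (s : ℝ) {μ : ℝ} {φ : H} (hφ : φ ∈ eigenspace A μ) : InDomPow A s φ :=
  summable_of_ne_finset_zero (s := {μ}) fun ν hν => by
    rw [eigenproj_of_mem_of_ne hdense hself (by simpa using hν) hφ]; simp

theorem opPow_of_mem_eigenspace (hdense : Dense (A.domain : Set H)) (hself : IsSelfAdjoint A)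
    (s : ℝ) {μ : ℝ} {φ : H} (hφ : φ ∈ eigenspace A μ) : opPow A s φ = μ ^ s • φ := by
  rw [opPow, tsum_eq_single μ, eigenproj_of_mem hself hφ]
  intro ν hν
  rw [eigenproj_of_mem_of_ne hdense hself hν hφ, smul_zero]

theorem inner_opPow (hdense : Dense (A.domain : Set H)) (hself : IsSelfAdjoint A)
    (hcoercive : IsCoercive A) {s : ℝ} {x : H} (h : InDomPow A s x) {μ : ℝ} {φ : H}
    (hφ : φ ∈ eigenspace A μ) : inner ℝ (opPow A s x) φ = μ ^ s * inner ℝ x φ := by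
  have hs := (h.summable hdense hself hcoercive).hasSum
  have h1 : HasSum (fun ν : ℝ => inner ℝ φ (ν ^ s • eigenproj A ν x)) (inner ℝ φ (opPow A s x)) :=
    hs.mapL (innerSL ℝ φ)
  have h2 := hasSum_single (f := fun ν : ℝ => inner ℝ φ (ν ^ s • eigenproj A ν x)) μ
    fun ν hν => by
      rw [real_inner_smul_right, inner_eq_zero_of_mem_eigenspace hdense hself hν.symm hφ
        (eigenproj_mem hself ν x), mul_zero]
  rw [real_inner_comm, h1.unique h2, real_inner_smul_right, real_inner_comm,
    inner_eigenproj μ x hφ]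

theorem eigenproj_opPow (hdense : Dense (A.domain : Set H)) (hself : IsSelfAdjoint A)
    (hcoercive : IsCoercive A) {s : ℝ} {x : H} (h : InDomPow A s x) (μ : ℝ) :
    eigenproj A μ (opPow A s x) = μ ^ s • eigenproj A μ x := by
  refine eigenproj_eq_of_inner hself (Submodule.smul_mem _ _ (eigenproj_mem hself μ x)) ?_
  intro φ hφ
  rw [inner_opPow hdense hself hcoercive h hφ, real_inner_smul_left, inner_eigenproj μ x hφ]

theorem hasSum_normW'_opPow_sq (hdense : Dense (A.domain : Set H)) (hself : IsSelfAdjoint A)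
    (hcoercive : IsCoercive A) {s : ℝ} {x : H} (h : InDomPow A s x) :
    HasSum (fun μ : ℝ => μ ^ (2 * s - 2) * ‖eigenproj A μ x‖ ^ 2) (normW' A (opPow A s x) ^ 2) := by
  obtain ⟨a, ha, hle⟩ := exists_le_eigenvalues hcoercive
  set y := opPow A s x with hy
  have hs := (((InDomPow.zero hdense hself y).mono hself hcoercive
    (by norm_num : (-2 : ℝ) ≤ 0)).summable hdense hself hcoercive).hasSum
  have h1 : HasSum (fun ν : ℝ => inner ℝ y (ν ^ (-2 : ℝ) • eigenproj A ν y))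
      (inner ℝ y (opPow A (-2) y)) := hs.mapL (innerSL ℝ y)
  have h2 : (fun ν : ℝ => inner ℝ y (ν ^ (-2 : ℝ) • eigenproj A ν y))
      = fun μ : ℝ => μ ^ (2 * s - 2) * ‖eigenproj A μ x‖ ^ 2 := by
    funext μ
    rw [real_inner_smul_right, real_inner_comm, ← norm_eigenproj_sq hself,
      eigenproj_opPow hdense hself hcoercive h]
    by_cases hμ : μ ∈ eigenvalues A
    · have hμ0 : 0 < μ := ha.trans_le (hle μ hμ)
      rw [norm_smul, mul_pow, Real.norm_of_nonneg (by positivity),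
        ← Real.rpow_mul_natCast hμ0.le, ← mul_assoc, ← Real.rpow_add hμ0]
      push_cast
      ring_nf
    · simp [eigenproj_of_notMem hself hμ]
  rw [h2] at h1
  have h0 : 0 ≤ inner ℝ y (opPow A (-2) y) := h1.nonneg fun μ => by
    by_cases hμ : μ ∈ eigenvalues A
    · have hμ0 : 0 < μ := ha.trans_le (hle μ hμ)
      positivity
    · simp [eigenproj_of_notMem hself hμ]
  rw [normW', Real.sq_sqrt (by rwa [real_inner_comm]), real_inner_comm]
  exact h1

end Spectral

/-- Uniform smallness of the coupling on the spectrum. -/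
theorem exists_coupling_bound {H : Type*} [NormedAddCommGroup H] [InnerProductSpace ℝ H]
    {A : H →ₗ.[ℝ] H} (hcoercive : IsCoercive A) {α β : ℝ} (hβ : β ≤ 3 / 2)
    (hαβ : |α| < firstEigenvalue A ^ ((3 - 2 * β) / 2)) :
    ∃ l q : ℝ, 0 < l ∧ 0 ≤ q ∧ q < 1 ∧
      ∀ μ ∈ eigenvalues A, l ≤ μ ∧ α ^ 2 * μ ^ (2 * β - 3) ≤ q ^ 2 := by
  obtain ⟨a, ha, hle⟩ := exists_le_eigenvalues hcoercive
  rcases (eigenvalues A).eq_empty_or_nonempty with he | hne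
  -- Without eigenvalues the infimum `firstEigenvalue A` carries no information, but the claim is
  -- vacuous.
  · exact ⟨1, 0, one_pos, le_rfl, one_pos, by simp [he]⟩
  set l := firstEigenvalue A with hl_def
  have hl : 0 < l := ha.trans_le (le_csInf hne hle)
  have hpos : 0 < l ^ ((3 - 2 * β) / 2) := by positivity
  -- The exponent `2 β - 3` is nonpositive, so the coupling is strongest at the first eigenvalue;
  -- `q` is its size there.
  refine ⟨l, |α| / l ^ ((3 - 2 * β) / 2), hl, by positivity, (div_lt_one hpos).2 hαβ, ?_⟩
  intro μ hμ
  have hlμ : l ≤ μ := csInf_le ⟨a, hle⟩ hμ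
  refine ⟨hlμ, ?_⟩
  rw [div_pow, sq_abs, div_eq_mul_inv, ← Real.rpow_mul_natCast hl.le, ← Real.rpow_neg hl.le]
  gcongr
  have : -((3 - 2 * β) / 2 * (2 : ℕ)) = 2 * β - 3 := by push_cast; ring
  rw [this]
  exact Real.rpow_le_rpow_of_nonpos hl hlμ (by linarith)

/-! ### Reduction of the system to modes, and summation. -/

section Modes

variable {H : Type*} [NormedAddCommGroup H] [InnerProductSpace ℝ H] [CompleteSpace H]
  {A : H →ₗ.[ℝ] H}

theorem IsSolution.hasDerivWithinAt_inner_u' (hdense : Dense (A.domain : Set H))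
    (hself : IsSelfAdjoint A) (hcoercive : IsCoercive A) {α β : ℝ} (hβ : β ≤ 3 / 2)
    {u u' : ℝ → H} {v : ℝ → A.domain} {v' : ℝ → H} (h : IsSolution A α β u u' v v')
    {μ : ℝ} (hμ : 0 < μ) {φ : H} (hφ : φ ∈ eigenspace A μ) {t : ℝ} (ht : 0 ≤ t) :
    HasDerivWithinAt (fun s => inner ℝ (u' s) φ)
      (-(inner ℝ (u' t) φ + μ * inner ℝ (u t) φ + α * μ ^ β * inner ℝ (v t : H) φ))
      (Ici 0) t := by
  refine (h.u_eq φ (.of_mem_eigenspace hdense hself _ hφ) t ht).congr_deriv ?_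
  -- Here `β ≤ 3 / 2` enters: `v t` lies in `D(A)` and `β - 1 / 2 ≤ 1`.
  have hv : InDomPow A (β - 1 / 2) (v t : H) :=
    (InDomPow.one hdense hself (v t)).mono hself hcoercive (by linarith)
  have e1 : μ ^ (1 / 2 : ℝ) * μ ^ (1 / 2 : ℝ) = μ := by
    rw [← Real.rpow_add hμ]; norm_num
  have e2 : μ ^ (1 / 2 : ℝ) * μ ^ (β - 1 / 2) = μ ^ β := by
    rw [← Real.rpow_add hμ]; ring_nf
  rw [opPow_of_mem_eigenspace hdense hself _ hφ, real_inner_smul_right, real_inner_smul_right,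
    inner_opPow hdense hself hcoercive (h.u_mem t ht) hφ,
    inner_opPow hdense hself hcoercive hv hφ, ← mul_assoc, e1, ← mul_assoc (μ ^ (1 / 2 : ℝ)), e2,
    mul_assoc α]

theorem IsSolution.hasDerivWithinAt_inner_v' (hdense : Dense (A.domain : Set H))
    (hself : IsSelfAdjoint A) (hcoercive : IsCoercive A) {α β : ℝ} (hβ : β ≤ 3 / 2)
    {u u' : ℝ → H} {v : ℝ → A.domain} {v' : ℝ → H} (h : IsSolution A α β u u' v v')
    {μ : ℝ} (hμ : 0 < μ) {φ : H} (hφ : φ ∈ eigenspace A μ) {t : ℝ} (ht : 0 ≤ t) :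
    HasDerivWithinAt (fun s => inner ℝ (v' s) φ)
      (-(μ ^ 2 * inner ℝ (v t : H) φ + α * μ ^ β * inner ℝ (u t) φ)) (Ici 0) t := by
  obtain ⟨ψ, rfl, hψ⟩ := (mem_eigenspace_iff A μ φ).1 hφ
  refine (h.v_eq ψ t ht).congr_deriv ?_
  have hu : InDomPow A (β - 1) (u t) := (h.u_mem t ht).mono hself hcoercive (by linarith)
  have e2 : μ * μ ^ (β - 1) = μ ^ β := by
    rw [Real.rpow_sub_one hμ.ne']; field_simp
  rw [hψ, real_inner_smul_right, real_inner_smul_right,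
    inner_opPow hdense hself hcoercive hu hφ, inner_apply_comm hdense hself, hψ,
    real_inner_smul_right, ← e2]
  ring

theorem hasSum_inner_sq_eigenproj (hself : IsSelfAdjoint A) {ι : Type*} {μ : ℝ}
    (b : HilbertBasis ι ℝ (eigenspace A μ)) (x : H) :
    HasSum (fun i => inner ℝ x (b i : H) ^ 2) (‖eigenproj A μ x‖ ^ 2) := by
  have h := b.hasSum_inner_mul_inner ⟨eigenproj A μ x, eigenproj_mem hself μ x⟩
    ⟨eigenproj A μ x, eigenproj_mem hself μ x⟩
  rw [real_inner_self_eq_norm_sq] at h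
  refine h.congr_fun ?_
  intro i
  rw [real_inner_comm _ (b i), ← sq]
  change _ = inner ℝ (eigenproj A μ x) (b i : H) ^ 2
  rw [inner_eigenproj μ x (b i).2]

theorem IsSolution.eigenproj_decay (hdense : Dense (A.domain : Set H))
    (hself : IsSelfAdjoint A) (hcoercive : IsCoercive A) (α : ℝ) {β l q : ℝ} (hβ : β ≤ 3 / 2)
    (hl : 0 < l) (hq0 : 0 ≤ q) (hq : q < 1) :
    ∃ C : ℝ, 0 < C ∧ ∀ (u u' : ℝ → H) (v : ℝ → A.domain) (v' : ℝ → H),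
      IsSolution A α β u u' v v' → ∀ μ, l ≤ μ → α ^ 2 * μ ^ (2 * β - 3) ≤ q ^ 2 → ∀ t, 0 ≤ t →
        t * (α ^ 2 * μ ^ (2 * β - 4)) * (‖eigenproj A μ (u' t)‖ ^ 2 + ‖eigenproj A μ (v' t)‖ ^ 2
            + μ * ‖eigenproj A μ (u t)‖ ^ 2 + μ ^ 2 * ‖eigenproj A μ (v t : H)‖ ^ 2)
          ≤ C * (‖eigenproj A μ (u' 0)‖ ^ 2 + ‖eigenproj A μ (v' 0)‖ ^ 2
            + μ * ‖eigenproj A μ (u 0)‖ ^ 2 + μ ^ 2 * ‖eigenproj A μ (v 0 : H)‖ ^ 2) := by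
  obtain ⟨C, hC, hdecay⟩ := mode_decay hl hq0 hq
  refine ⟨C, hC, fun u u' v v' h μ hμ hαμ t ht => ?_⟩
  have hμ0 : 0 < μ := hl.trans_le hμ
  have : CompleteSpace (eigenspace A μ) := (isClosed_eigenspace hself μ).completeSpace_coe
  -- The scalar estimate holds along each basis vector with the same constant, so Parseval sums it
  -- whatever the multiplicity of `μ`.
  obtain ⟨w, b, -⟩ := exists_hilbertBasis ℝ (eigenspace A μ)
  have hsum (s : ℝ) := (((hasSum_inner_sq_eigenproj hself b (u' s)).add
    (hasSum_inner_sq_eigenproj hself b (v' s))).add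
    ((hasSum_inner_sq_eigenproj hself b (u s)).mul_left μ)).add
    ((hasSum_inner_sq_eigenproj hself b (v s : H)).mul_left (μ ^ 2))
  refine hasSum_le (fun i => ?_) ((hsum t).mul_left (t * (α ^ 2 * μ ^ (2 * β - 4))))
    ((hsum 0).mul_left C)
  have e1 : (α * μ ^ (β - 2)) ^ 2 = α ^ 2 * μ ^ (2 * β - 4) := by
    rw [mul_pow, ← Real.rpow_mul_natCast hμ0.le]; push_cast; ring_nf
  have e2 : μ ^ (2 * β - 4) * μ = μ ^ (2 * β - 3) := by
    rw [← Real.rpow_add_one hμ0.ne']; ring_nf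
  have e3 : α * μ ^ (β - 2) * μ ^ 2 = α * μ ^ β := by
    rw [mul_assoc, ← Real.rpow_natCast μ 2, ← Real.rpow_add hμ0]; push_cast; ring_nf
  have hd (f f' : ℝ → H) (hf : ∀ s, 0 ≤ s → HasDerivWithinAt f (f' s) (Ici 0) s) (s : ℝ)
      (hs : 0 ≤ s) :
      HasDerivWithinAt (fun s => inner ℝ (f s) (b i : H)) (inner ℝ (f' s) (b i : H)) (Ici 0) s := by
    simpa using (hf s hs).inner ℝ (hasDerivWithinAt_const s (Ici 0) (b i : H))
  rw [← e1]
  refine hdecay μ (α * μ ^ (β - 2)) hμ (by rw [e1, mul_assoc, e2]; exact hαμ)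
    (fun s => inner ℝ (u s) (b i : H)) (fun s => inner ℝ (u' s) (b i : H))
    (fun s => inner ℝ (v s : H) (b i : H)) (fun s => inner ℝ (v' s) (b i : H))
    (hd u u' h.u_deriv) (hd _ v' h.v_deriv) ?_ ?_ t ht
  · intro s hs
    rw [e3]
    exact h.hasDerivWithinAt_inner_u' hdense hself hcoercive hβ hμ0 (b i).2 hs
  · intro s hs
    rw [e3]
    exact h.hasDerivWithinAt_inner_v' hdense hself hcoercive hβ hμ0 (b i).2 hs

/-- Bessel's inequality for the energy, resolved into the eigenspaces of `A`. -/
theorem exists_hasSum_energy_le (hdense : Dense (A.domain : Set H)) (hself : IsSelfAdjoint A)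
    (hcoercive : IsCoercive A) {x : H} (hx : InDomPow A (1 / 2) x) (x' : H) (y : A.domain)
    (y' : H) :
    ∃ S ≤ ‖x'‖ ^ 2 + ‖y'‖ ^ 2 + normV A x ^ 2 + normW A y ^ 2,
      HasSum (fun μ => ‖eigenproj A μ x'‖ ^ 2 + ‖eigenproj A μ y'‖ ^ 2
        + μ * ‖eigenproj A μ x‖ ^ 2 + μ ^ 2 * ‖eigenproj A μ (y : H)‖ ^ 2) S := by
  obtain ⟨a, ha, hle⟩ := exists_le_eigenvalues hcoercive
  have hsum (z : H) := (summable_norm_eigenproj_sq hdense hself z).hasSum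
  have hb (z : H) := tsum_norm_eigenproj_sq_le hdense hself z
  refine ⟨_, add_le_add (add_le_add (add_le_add (hb x') (hb y')) (hb (opPow A (1 / 2) x)))
    (hb (A y)), ?_⟩
  refine (((hsum x').add (hsum y')).add ((hsum _).congr_fun fun μ => ?_)).add
    ((hsum _).congr_fun fun μ => ?_)
  · rw [eigenproj_opPow hdense hself hcoercive hx]
    by_cases hμ : μ ∈ eigenvalues A
    · have hμ0 : 0 < μ := ha.trans_le (hle μ hμ)
      rw [norm_smul, mul_pow, Real.norm_of_nonneg (by positivity),
        ← Real.rpow_mul_natCast hμ0.le]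
      norm_num
    · simp [eigenproj_of_notMem hself hμ]
  · rw [eigenproj_apply hdense hself, norm_smul, mul_pow, Real.norm_eq_abs, sq_abs]

/-- The decay estimate with the general weight `A ^ (-δ / 2)`, `4 - 2 β ≤ δ`, on the energy norm.
The norms only involve the components in the eigenspaces of `A`, each of which decays with a
constant independent of the eigenvalue, so Bessel's inequality suffices to sum them. -/
theorem IsSolution.weighted_decay (hdense : Dense (A.domain : Set H))
    (hself : IsSelfAdjoint A) (hcoercive : IsCoercive A) {α β l q : ℝ} (hα : α ≠ 0)
    (hβ : β ≤ 3 / 2) (hl : 0 < l) (hq0 : 0 ≤ q) (hq : q < 1)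
    (hlq : ∀ μ ∈ eigenvalues A, l ≤ μ ∧ α ^ 2 * μ ^ (2 * β - 3) ≤ q ^ 2) {δ : ℝ} (hδ2 : 2 ≤ δ)
    (hδ : 4 - 2 * β ≤ δ) :
    ∃ c : ℝ, 0 < c ∧ ∀ (u u' : ℝ → H) (v : ℝ → A.domain) (v' : ℝ → H),
      IsSolution A α β u u' v v' → ∀ t : ℝ, 0 < t →
        normW' A (opPow A (1 - δ / 2) (u' t)) ^ 2 + normW' A (opPow A (1 - δ / 2) (v' t)) ^ 2
            + normW' A (opPow A (3 / 2 - δ / 2) (u t)) ^ 2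
            + normW' A (opPow A (2 - δ / 2) (v t : H)) ^ 2
          ≤ c / t * (‖u' 0‖ ^ 2 + ‖v' 0‖ ^ 2 + normV A (u 0) ^ 2 + normW A (v 0) ^ 2) := by
  obtain ⟨C, hC, hdecay⟩ := IsSolution.eigenproj_decay hdense hself hcoercive α hβ hl hq0 hq
  have hα2 : 0 < α ^ 2 := by positivity
  -- The power of `l` bounds `μ ^ (4 - 2 β - δ)`, the excess of the weight over `ρ²`; `α²` is the
  -- constant factor of `ρ²`.
  refine ⟨l ^ (4 - 2 * β - δ) / α ^ 2 * C, by positivity, fun u u' v v' h t ht => ?_⟩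
  obtain ⟨S, hSle, hS⟩ :=
    exists_hasSum_energy_le hdense hself hcoercive (h.u_mem 0 le_rfl) (u' 0) (v 0) (v' 0)
  have hzero (z : H) : InDomPow A (1 - δ / 2) z :=
    (InDomPow.zero hdense hself z).mono hself hcoercive (by linarith)
  have hu : InDomPow A (3 / 2 - δ / 2) (u t) :=
    (h.u_mem t ht.le).mono hself hcoercive (by linarith)
  have hv : InDomPow A (2 - δ / 2) (v t : H) :=
    (InDomPow.one hdense hself (v t)).mono hself hcoercive (by linarith)
  have hT := (((hasSum_normW'_opPow_sq hdense hself hcoercive (hzero (u' t))).add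
    (hasSum_normW'_opPow_sq hdense hself hcoercive (hzero (v' t)))).add
    (hasSum_normW'_opPow_sq hdense hself hcoercive hu)).add
    (hasSum_normW'_opPow_sq hdense hself hcoercive hv)
  have hc : 0 ≤ l ^ (4 - 2 * β - δ) / α ^ 2 * C / t := by positivity
  refine (hasSum_le (fun μ => ?_) hT (hS.mul_left _)).trans
    (mul_le_mul_of_nonneg_left hSle hc)
  by_cases hμ : μ ∈ eigenvalues A
  · obtain ⟨hlμ, hqμ⟩ := hlq μ hμ
    have hμ0 : 0 < μ := hl.trans_le hlμ
    have hd := hdecay u u' v v' h μ hlμ hqμ t ht.le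
    set N := ‖eigenproj A μ (u' t)‖ ^ 2 + ‖eigenproj A μ (v' t)‖ ^ 2
            + μ * ‖eigenproj A μ (u t)‖ ^ 2 + μ ^ 2 * ‖eigenproj A μ (v t : H)‖ ^ 2 with hN
    set N₀ := ‖eigenproj A μ (u' 0)‖ ^ 2 + ‖eigenproj A μ (v' 0)‖ ^ 2
            + μ * ‖eigenproj A μ (u 0)‖ ^ 2 + μ ^ 2 * ‖eigenproj A μ (v 0 : H)‖ ^ 2
    have hN0 : 0 ≤ N := by positivity
    have e0 : μ ^ (2 * (1 - δ / 2) - 2) = μ ^ (-δ) := by ring_nf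
    have e1 : μ ^ (2 * (3 / 2 - δ / 2) - 2) = μ ^ (-δ) * μ := by
      rw [← Real.rpow_add_one hμ0.ne']; ring_nf
    have e2 : μ ^ (2 * (2 - δ / 2) - 2) = μ ^ (-δ) * μ ^ 2 := by
      rw [← Real.rpow_natCast μ 2, ← Real.rpow_add hμ0]; push_cast; ring_nf
    have hw : μ ^ (-δ) ≤ l ^ (4 - 2 * β - δ) * μ ^ (2 * β - 4) := by
      calc μ ^ (-δ) = μ ^ (4 - 2 * β - δ) * μ ^ (2 * β - 4) := by
            rw [← Real.rpow_add hμ0]; ring_nf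
        _ ≤ _ := by
            gcongr ?_ * _
            exact Real.rpow_le_rpow_of_nonpos hl hlμ (by linarith)
    rw [e0, e1, e2]
    calc _ = μ ^ (-δ) * N := by rw [hN]; ring
      _ ≤ l ^ (4 - 2 * β - δ) * μ ^ (2 * β - 4) * N := by gcongr
      _ = l ^ (4 - 2 * β - δ) / α ^ 2 / t * (t * (α ^ 2 * μ ^ (2 * β - 4)) * N) := by
          field_simp
      _ ≤ l ^ (4 - 2 * β - δ) / α ^ 2 / t * (C * N₀) := by gcongr
      _ = _ := by ring
  · simp [eigenproj_of_notMem hself hμ]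

end Modes

end CoupledSystem

theorem theorem2 {H : Type*} [NormedAddCommGroup H] [InnerProductSpace ℝ H] [CompleteSpace H]
    (A : H →ₗ.[ℝ] H) (hdense : Dense (A.domain : Set H)) (hself : IsSelfAdjoint A)
    (hcompact : CoupledSystem.HasCompactDomain A) (hcoercive : CoupledSystem.IsCoercive A)
    (α β : ℝ) (hα : α ≠ 0) (hβ : β ∈ Set.Icc (0 : ℝ) (3 / 2))
    (hαβ : |α| < CoupledSystem.firstEigenvalue A ^ ((3 - 2 * β) / 2)) :
    ∃ c : ℝ, 0 < c ∧
      ∀ (u u' : ℝ → H) (v : ℝ → A.domain) (v' : ℝ → H),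
        CoupledSystem.IsSolution A α β u u' v v' →
        (β ∈ Set.Icc (0 : ℝ) 1 → ∀ t : ℝ, 0 < t →
          CoupledSystem.normW' A (CoupledSystem.opPow A (β / 2 - 1) (u' t)) ^ 2
            + CoupledSystem.normW' A (CoupledSystem.opPow A (β / 2 - 1) (v' t)) ^ 2
            + CoupledSystem.normW' A (CoupledSystem.opPow A ((β - 1) / 2) (u t)) ^ 2
            + CoupledSystem.normW' A (CoupledSystem.opPow A (β / 2) (v t : H)) ^ 2
          ≤ c / t * (‖u' 0‖ ^ 2 + ‖v' 0‖ ^ 2 + CoupledSystem.normV A (u 0) ^ 2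
              + CoupledSystem.normW A (v 0) ^ 2)) ∧
        (β ∈ Set.Icc (1 : ℝ) (3 / 2) → ∀ t : ℝ, 0 < t →
          CoupledSystem.normW' A (CoupledSystem.opPow A (-β / 2) (u' t)) ^ 2
            + CoupledSystem.normW' A (CoupledSystem.opPow A (-β / 2) (v' t)) ^ 2
            + CoupledSystem.normW' A (CoupledSystem.opPow A ((1 - β) / 2) (u t)) ^ 2
            + CoupledSystem.normW' A (CoupledSystem.opPow A (1 - β / 2) (v t : H)) ^ 2
          ≤ c / t * (‖u' 0‖ ^ 2 + ‖v' 0‖ ^ 2 + CoupledSystem.normV A (u 0) ^ 2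
              + CoupledSystem.normW A (v 0) ^ 2)) := by
  obtain ⟨l, q, hl, hq0, hq, hlq⟩ := CoupledSystem.exists_coupling_bound hcoercive hβ.2 hαβ
  -- `δ` solves `1 - δ / 2 = β / 2 - 1`, respectively `1 - δ / 2 = -β / 2`. Both values are `3` at
  -- the common endpoint `β = 1`, so one constant serves both claims.
  obtain ⟨δ, hδ⟩ : ∃ δ : ℝ, δ = if β ≤ 1 then 4 - β else 2 + β := ⟨_, rfl⟩
  have hδ2 : 2 ≤ δ ∧ 4 - 2 * β ≤ δ := by
    rw [hδ]
    split_ifs <;> constructor <;> linarith [hβ.1, hβ.2]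
  obtain ⟨c, hc, hdecay⟩ := CoupledSystem.IsSolution.weighted_decay hdense hself hcoercive hα
    hβ.2 hl hq0 hq hlq hδ2.1 hδ2.2
  refine ⟨c, hc, fun u u' v v' h => ⟨fun hβ1 t ht => ?_, fun hβ1 t ht => ?_⟩⟩
  · have hd := hdecay u u' v v' h t ht
    have hδ' : δ = 4 - β := by rw [hδ, if_pos hβ1.2]
    rw [show 1 - δ / 2 = β / 2 - 1 by rw [hδ']; ring,
      show 3 / 2 - δ / 2 = (β - 1) / 2 by rw [hδ']; ring,
      show 2 - δ / 2 = β / 2 by rw [hδ']; ring] at hd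
    exact hd
  · have hd := hdecay u u' v v' h t ht
    have hδ' : δ = 2 + β := by
      rw [hδ]
      split_ifs with h1
      · linarith [le_antisymm h1 hβ1.1]
      · rfl
    rw [show 1 - δ / 2 = -β / 2 by rw [hδ']; ring,
      show 3 / 2 - δ / 2 = (1 - β) / 2 by rw [hδ']; ring,
      show 2 - δ / 2 = 1 - β / 2 by rw [hδ']; ring] at hd
    exact hd
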